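/- Let $q$ be a prime power, let $m\ge 2$, and let $\Phi(x)=\sum_{i=0}^{2m}c_i x^{q^i}\in\mathbb F_q[x]$ be a $q$-polynomial with $c_{2m}=1$, with $c_i=-c_{2m-i}$ for $0\le i\le m$, and with $c_m=0$. Put $$L(x)=\Phi(x)+t^q x^{q^{m+1}}-t\,x^{q^{m-1}}\in\mathbb F_q(t)[x],$$ let $E$ be a splitting field of $L$ over $\mathbb F_q(t)$, let $G$ be the Galois group of $E$ over $\mathbb F_q(t)$, and let $V$ be the $\mathbb F_q$-vector space of roots of $L$ in $E$. There is a unique monic polynomial $f\in\mathbb F_q[x]$ of degree $q^{m-1}(q^m+1)$ with $f(0)=0$ and $f^q-f=x^{q^m}\Phi$; define $Q(v)=t\,v^{q^m+q^{m-1}}+f(v)$ for $v\in V$. Then: (a) $V$ has dimension $2m$ over $\mathbb F_q$, and $Q$ is an $\mathbb F_q$-valued quadratic form on $V$ whose polarization $Q(u+w)-Q(u)-Q(w)$ is nondegenerate and which has exactly $(q^{m-1}-1)(q^m+1)$ nonzero isotropic vectors (nonzero $v$ with $Q(v)=0$); that is, $Q$ is of minus type, and its group of linear isometries is $O^-(2m,q)$.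 The group $G$ acts faithfully on $V$ by $\mathbb F_q$-linear isometries of $Q$, so that $G$ is a subgroup of $O^-(2m,q)$. (b) For every $\lambda\in\mathbb F_q$, the set $\{v\in V : v\neq 0,\ Q(v)=\lambda\}$ is nonempty and $G$ acts transitively on it. -/

import Mathlib

open Polynomial

noncomputable section

namespace QAntiPalindromic

section Polynomials

variable {F : Type*} [Field F] [Fintype F]

/-- With `q = |F|`, the `q`-polynomial `c₀ x + c₁ x^q + ⋯ + c_d x^(q^d)` over `F`. -/
def qPoly (c : ℕ → F) (d : ℕ) : F[X] :=
  ∑ i ∈ Finset.range (d + 1), C (c i) * X ^ (Fintype.card F ^ i)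

/-- The polynomial `qPoly c (2 * m)` is monic of `q`-degree `2m`, it is `q`-anti-palindromic
(that is, `c_i = -c_{2m-i}` for `0 ≤ i ≤ m`), and its coefficient of `x^(q^m)` is zero. -/
structure IsMonicAntiPalindromic (c : ℕ → F) (m : ℕ) : Prop where
  monic : c (2 * m) = 1
  anti : ∀ i ≤ m, c i = -c (2 * m - i)
  middle : c m = 0

/-- The polynomial `L(x) = Φ(x) + t^q x^(q^(m+1)) - t x^(q^(m-1))` over `F(t)`, where `Φ` is
the `q`-polynomial `qPoly c (2 * m)`. The variable `t` of the rational function field is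
`RatFunc.X`. -/
def L (c : ℕ → F) (m : ℕ) : (RatFunc F)[X] :=
  (qPoly c (2 * m)).map (algebraMap F (RatFunc F))
    + C (RatFunc.X ^ Fintype.card F) * X ^ (Fintype.card F ^ (m + 1))
    - C RatFunc.X * X ^ (Fintype.card F ^ (m - 1))

/-- `f` is a monic polynomial of degree `q^(m-1) (q^m + 1)` over `F`, with `f(0) = 0` and
`f^q - f = x^(q^m) Φ`, where `Φ` is the `q`-polynomial `qPoly c (2 * m)`. -/
structure IsAssociated (c : ℕ → F) (m : ℕ) (f : F[X]) : Prop where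
  monic : f.Monic
  natDegree_eq : f.natDegree = Fintype.card F ^ (m - 1) * (Fintype.card F ^ m + 1)
  eval_zero : f.eval 0 = 0
  pow_sub : f ^ Fintype.card F - f = X ^ (Fintype.card F ^ m) * qPoly c (2 * m)

end Polynomials

section RootSpace

variable {F : Type*} [Field F] [Fintype F]
variable (E : Type*) [Field E] [Algebra F E]

theorem add_pow_card_pow (i : ℕ) (x y : E) :
    (x + y) ^ (Fintype.card F ^ i) = x ^ (Fintype.card F ^ i) + y ^ (Fintype.card F ^ i) := by
  induction i with
  | zero => simp
  | succ k ih =>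
    have h := map_add (FiniteField.frobeniusAlgHom F E)
      (x ^ (Fintype.card F ^ k)) (y ^ (Fintype.card F ^ k))
    simp only [FiniteField.frobeniusAlgHom_apply] at h
    rw [pow_succ, pow_mul, pow_mul, pow_mul, ih, h]

theorem smul_pow_card_pow (i : ℕ) (a : F) (x : E) :
    (a • x) ^ (Fintype.card F ^ i) = a • x ^ (Fintype.card F ^ i) := by
  rw [_root_.smul_pow, FiniteField.pow_card_pow]

variable [Algebra (RatFunc F) E] [IsScalarTower F (RatFunc F) E]

theorem aeval_L (c : ℕ → F) (m : ℕ) (x : E) :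
    aeval x (L c m) =
      ∑ i ∈ Finset.range (2 * m + 1), c i • x ^ (Fintype.card F ^ i)
        + algebraMap (RatFunc F) E RatFunc.X ^ Fintype.card F * x ^ (Fintype.card F ^ (m + 1))
        - algebraMap (RatFunc F) E RatFunc.X * x ^ (Fintype.card F ^ (m - 1)) := by
  simp only [L, map_sub, map_add, aeval_map_algebraMap, qPoly, map_sum, map_mul, map_pow,
    aeval_C, aeval_X, Algebra.smul_def]

/-- The space of roots of `L c m` in `E`, as an `F`-subspace of `E`. -/
def rootSpace (c : ℕ → F) (m : ℕ) : Submodule F E where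
  carrier := {x | aeval x (L c m) = 0}
  zero_mem' := by
    have hq : Fintype.card F ≠ 0 := Fintype.card_ne_zero
    simp [aeval_L, hq]
  add_mem' := by
    intro x y hx hy
    simp only [Set.mem_ofPred_eq, aeval_L] at hx hy ⊢
    simp only [add_pow_card_pow (F := F), smul_add, Finset.sum_add_distrib]
    linear_combination hx + hy
  smul_mem' := by
    intro a x hx
    simp only [Set.mem_ofPred_eq, aeval_L] at hx ⊢
    simp only [smul_pow_card_pow (F := F), smul_comm _ a, ← Finset.smul_sum,
      mul_smul_comm, ← smul_add, ← smul_sub, hx, smul_zero]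

variable {E}

theorem apply_mem_rootSpace {c : ℕ → F} {m : ℕ} (σ : E ≃ₐ[RatFunc F] E) {x : E}
    (hx : x ∈ rootSpace E c m) : σ x ∈ rootSpace E c m := by
  change aeval (σ x) (L c m) = 0
  have hx' : aeval x (L c m) = 0 := hx
  have h := aeval_algHom_apply σ.toAlgHom x (L c m)
  rw [hx', map_zero] at h
  exact h

variable (E)

/-- The natural action of the Galois group on the space of roots, by `F`-linear
automorphisms: `σ` sends a root `v` to `σ v`. -/
def galRep (c : ℕ → F) (m : ℕ) :
    (E ≃ₐ[RatFunc F] E) →* (rootSpace E c m ≃ₗ[F] rootSpace E c m) where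
  toFun σ :=
    { toFun := fun v => ⟨σ v, apply_mem_rootSpace σ v.2⟩
      invFun := fun v => ⟨σ.symm v, apply_mem_rootSpace σ.symm v.2⟩
      map_add' := fun v w => Subtype.ext (by simp)
      map_smul' := fun a v => Subtype.ext 
        ((σ.toLinearMap.restrictScalars F).map_smul a (v : E))
      left_inv := fun v => Subtype.ext (by simp)
      right_inv := fun v => Subtype.ext (by simp) }
  map_one' := by ext v; rfl
  map_mul' σ τ := by ext v; rfl

end RootSpace

section Orthogonal

variable {F V : Type*} [Field F] [AddCommGroup V] [Module F V]

/-- The orthogonal group of a quadratic form: the group of its (linear) isometries. -/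
def orthogonalGroup (Q : QuadraticForm F V) : Subgroup (V ≃ₗ[F] V) where
  carrier := {g | ∀ v, Q (g v) = Q v}
  one_mem' := fun _ => rfl
  mul_mem' := fun {g h} hg hh v => (hg (h v)).trans (hh v)
  inv_mem' := fun {g} hg v => by
    have h := hg (g⁻¹ v)
    rw [← h]
    exact congrArg Q (g.apply_symm_apply v)

/-- `Q` is a nondegenerate quadratic form of minus type on a space of dimension `2m` over the
field with `q` elements, i.e. its polarization is nondegenerate and it has exactly
`(q^(m-1) - 1) (q^m + 1)` nonzero isotropic vectors (the forms of the other, plus, type have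
`(q^(m-1) + 1) (q^m - 1)` of them). Its orthogonal group is then, by definition,
`O⁻(2m, q)`. -/
structure IsMinusType [Fintype F] (Q : QuadraticForm F V) (m : ℕ) : Prop where
  finrank_eq : Module.finrank F V = 2 * m
  nondegenerate : (QuadraticMap.polarBilin Q).Nondegenerate
  card_isotropic : {v : V | v ≠ 0 ∧ Q v = 0}.ncard =
    (Fintype.card F ^ (m - 1) - 1) * (Fintype.card F ^ m + 1)

end Orthogonal

end QAntiPalindromic

end

noncomputable section

namespace QAntiPalindromic

/-! ### The polynomial `f`: existence, uniqueness, order of vanishing at zero. -/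

section Polynomials

variable {F : Type*} [Field F] [Fintype F]

local notation "q" => Fintype.card F

/-! Everything follows from one identity: P = t x^(q^m + q^(m-1)) + f satisfies P^q - P = x^(q^m) L
(`formPoly_pow_sub`). Hence P takes values in F_q on V, and for each λ in F_q the nonzero roots of P
- λ are exactly the nonzero v in V with Q(v) = λ. Since P - λ has degree one in t, Gauss's lemma
makes it irreducible over F_q(t) once its power of x is removed (`exists_irreducible_factor`).
Transitivity on each level set is then transitivity of a Galois group on the roots of an irreducible
polynomial. As L' = -1, L is separable, so each level set has as many elements as the degree of its
factor; for λ = 0 this is deg P - (q^m + 1), the minus-type count. Nondegeneracy comes from P' =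
x^(q^m) and deg P < |V| (`formPoly_radical_eq_zero`). That Q is quadratic is visible from the
explicit f (`assoc`), a combination of monomials x^(q^a + q^b). -/

theorem poly_sub_pow_card {A : Type*} [CommRing A] [Algebra F A] (x y : A) :
    (x - y) ^ q = x ^ q - y ^ q := by
  simpa only [FiniteField.frobeniusAlgHom_apply] using
    map_sub (FiniteField.frobeniusAlgHom F A) x y

theorem poly_add_pow_card {A : Type*} [CommRing A] [Algebra F A] (x y : A) :
    (x + y) ^ q = x ^ q + y ^ q := by
  simpa only [FiniteField.frobeniusAlgHom_apply] using
    map_add (FiniteField.frobeniusAlgHom F A) x y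

theorem poly_sum_pow_card {A ι : Type*} [CommRing A] [Algebra F A] (s : Finset ι) (x : ι → A) :
    (∑ i ∈ s, x i) ^ q = ∑ i ∈ s, x i ^ q := by
  simpa only [FiniteField.frobeniusAlgHom_apply] using
    map_sum (FiniteField.frobeniusAlgHom F A) x s

theorem qPoly_monic_and_natDegree (c : ℕ → F) (d : ℕ) (hd : c d = 1) :
    (qPoly c d).Monic ∧ (qPoly c d).natDegree = q ^ d := by
  have hlt : (∑ i ∈ Finset.range d, C (c i) * X ^ (q ^ i)).degree < ((q ^ d : ℕ) : WithBot ℕ) := by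
    refine (degree_sum_le _ _).trans_lt ?_
    rw [Finset.sup_lt_iff (WithBot.bot_lt_coe _)]
    intro i hi
    refine (degree_C_mul_X_pow_le _ _).trans_lt ?_
    exact_mod_cast Nat.pow_lt_pow_right Fintype.one_lt_card (Finset.mem_range.1 hi)
  have h : qPoly c d = X ^ (q ^ d) + ∑ i ∈ Finset.range d, C (c i) * X ^ (q ^ i) := by
    rw [qPoly, Finset.sum_range_succ, hd, C_1, one_mul, add_comm]
  rw [h]
  exact ⟨monic_X_pow_add hlt, by
    rw [natDegree_add_eq_left_of_degree_lt (by rwa [degree_X_pow]), natDegree_X_pow]⟩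

/-- `P` is not constant because `R` is not, so `P ^ q` dominates `P` and carries the leading term of
`R`. -/
theorem monic_and_natDegree_of_pow_card_sub {K : Type*} [Field K] [Algebra F K] {P R : K[X]}
    {n : ℕ} (hR : R.Monic) (hn : 0 < n) (hd : R.natDegree = q * n) (h : P ^ q - P = R) :
    P.natDegree = n ∧ P.leadingCoeff ^ q = 1 := by
  have hq : 1 < q := Fintype.one_lt_card
  have hP : 0 < P.natDegree := by
    by_contra h0
    rw [eq_C_of_natDegree_eq_zero (p := P) (by omega), ← C_pow, ← C_sub] at h
    rw [← h, natDegree_C] at hd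
    have := Nat.mul_pos (by omega : 0 < q) hn
    omega
  have hlt : P.degree < (P ^ q).degree := by
    refine degree_lt_degree ?_
    rw [natDegree_pow]
    nlinarith
  constructor
  · have h2 := natDegree_sub_eq_left_of_natDegree_lt (natDegree_lt_natDegree (by aesop) hlt)
    rw [h, hd, natDegree_pow] at h2
    exact (Nat.eq_of_mul_eq_mul_left (by omega) h2).symm
  · have h2 := leadingCoeff_sub_of_degree_lt hlt
    rw [h, hR.leadingCoeff, leadingCoeff_pow] at h2
    exact h2.symm

theorem pow_add_pow_two_mul (r : ℕ) {m : ℕ} (hm : 1 ≤ m) :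
    r ^ m + r ^ (2 * m) = r * (r ^ (m - 1) * (r ^ m + 1)) := by
  obtain ⟨k, rfl⟩ : ∃ k, m = k + 1 := ⟨m - 1, by omega⟩
  simp only [Nat.add_sub_cancel]
  ring

/-- The polynomial `∑_{j ≤ m} c_{m+j} ∑_{k < j} x^(q^(m+k) + q^(m+k-j))`. -/
def assoc (c : ℕ → F) (m : ℕ) : F[X] :=
  ∑ j ∈ Finset.range (m + 1), ∑ k ∈ Finset.range j,
    C (c (m + j)) * X ^ (q ^ (m + k) + q ^ (m + k - j))

/-- The q-th power shifts `k` to `k + 1`, so each inner sum telescopes to its two end terms. The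
upper ends give the coefficients of Φ from `m` on; anti-palindromicity turns the lower ends into
those below `m`. -/
theorem assoc_pow_sub {c : ℕ → F} {m : ℕ} (hc : IsMonicAntiPalindromic c m) :
    assoc c m ^ q - assoc c m = X ^ (q ^ m) * qPoly c (2 * m) := by
  have h1 : assoc c m ^ q - assoc c m = ∑ j ∈ Finset.range (m + 1),
      (C (c (m + j)) * X ^ (q ^ (m + j) + q ^ m) - C (c (m + j)) * X ^ (q ^ m + q ^ (m - j))) := by
    rw [assoc, poly_sum_pow_card (F := F), ← Finset.sum_sub_distrib]
    refine Finset.sum_congr rfl fun j hj => ?_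
    rw [poly_sum_pow_card (F := F), ← Finset.sum_sub_distrib]
    have hj' : j ≤ m := by simpa [Nat.lt_succ_iff] using hj
    have := Finset.sum_range_sub
      (fun k => C (c (m + j)) * (X : F[X]) ^ (q ^ (m + k) + q ^ (m + k - j))) j
    simp only [Nat.add_sub_cancel, add_zero] at this
    rw [← this]
    refine Finset.sum_congr rfl fun k _ => ?_
    rw [mul_pow, ← C_pow, FiniteField.pow_card, ← pow_mul, add_mul, ← pow_succ, ← pow_succ,
      ← add_assoc, show m + k + 1 - j = m + k - j + 1 by omega]
  have h2 : qPoly c (2 * m) = ∑ i ∈ Finset.range m, C (c i) * X ^ (q ^ i)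
      + ∑ j ∈ Finset.range (m + 1), C (c (m + j)) * X ^ (q ^ (m + j)) := by
    rw [qPoly, two_mul, add_assoc, Finset.sum_range_add]
  have h3 : ∑ j ∈ Finset.range (m + 1), C (c (m + j)) * (X : F[X]) ^ (q ^ (m - j))
      = - ∑ i ∈ Finset.range m, C (c i) * X ^ (q ^ i) := by
    rw [← Finset.sum_range_reflect, Finset.sum_range_succ]
    have : m + (m + 1 - 1 - m) = m := by omega
    rw [this, hc.middle, C_0, zero_mul, add_zero, ← Finset.sum_neg_distrib]
    refine Finset.sum_congr rfl fun i hi => ?_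
    have hi := Finset.mem_range.1 hi
    rw [hc.anti i hi.le, show m + (m + 1 - 1 - i) = 2 * m - i by omega,
      show m - (m + 1 - 1 - i) = i by omega, C_neg, neg_mul, neg_neg]
  rw [h1, h2, Finset.sum_sub_distrib]
  simp only [pow_add, ← mul_assoc]
  rw [← Finset.sum_mul]
  have h4 : ∑ j ∈ Finset.range (m + 1), C (c (m + j)) * (X : F[X]) ^ (q ^ m) * X ^ (q ^ (m - j))
      = X ^ (q ^ m) *
        ∑ j ∈ Finset.range (m + 1), C (c (m + j)) * (X : F[X]) ^ (q ^ (m - j)) := by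
    rw [Finset.mul_sum]
    exact Finset.sum_congr rfl fun _ _ => by ring
  rw [h4, h3]
  ring

theorem isAssociated_assoc {c : ℕ → F} {m : ℕ} (hm : 2 ≤ m) (hc : IsMonicAntiPalindromic c m) :
    IsAssociated c m (assoc c m) := by
  have hq : 1 < q := Fintype.one_lt_card
  obtain ⟨hmon, hdeg⟩ := qPoly_monic_and_natDegree c (2 * m) hc.monic
  have key := monic_and_natDegree_of_pow_card_sub (F := F) (P := assoc c m)
    (R := X ^ (q ^ m) * qPoly c (2 * m)) (n := q ^ (m - 1) * (q ^ m + 1))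
    ((monic_X_pow _).mul hmon) (by positivity)
    (by rw [(monic_X_pow _).natDegree_mul hmon, natDegree_X_pow, hdeg, pow_add_pow_two_mul _ (by omega)])
    (assoc_pow_sub hc)
  refine ⟨?_, key.1, ?_, assoc_pow_sub hc⟩
  · have := key.2
    rwa [FiniteField.pow_card] at this
  · simp only [assoc, eval_finsetSum, eval_mul, eval_C, eval_pow, eval_X]
    refine Finset.sum_eq_zero fun j _ => Finset.sum_eq_zero fun k _ => ?_
    rw [zero_pow (by positivity), mul_zero]

/-- The difference equals its own q-th power, hence is a constant, and it vanishes at 0. -/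
theorem IsAssociated.unique {c : ℕ → F} {m : ℕ} {f g : F[X]} (hf : IsAssociated c m f)
    (hg : IsAssociated c m g) : f = g := by
  have h : (f - g) ^ q = f - g := by
    rw [poly_sub_pow_card (F := F)]
    linear_combination hf.pow_sub - hg.pow_sub
  have hq : 1 < q := Fintype.one_lt_card
  have h0 : (f - g).natDegree = 0 := by
    have := congrArg natDegree h
    rw [natDegree_pow] at this
    by_contra h0
    have : 0 < (f - g).natDegree := by omega
    nlinarith
  rw [natDegree_eq_zero] at h0
  obtain ⟨a, ha⟩ := h0
  have h1 : a = 0 := by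
    have := congrArg (eval 0) ha
    simpa [hf.eval_zero, hg.eval_zero] using this
  rw [h1, C_0] at ha
  exact sub_eq_zero.1 ha.symm

/-- In f (f^(q-1) - 1) = x^(q^m) Φ the second factor is -1 at 0, so f absorbs the whole power of x.
Φ contributes one more x, with coefficient `c 0 = -1`. -/
theorem IsAssociated.exists_eq_X_pow_mul {c : ℕ → F} {m : ℕ} {f : F[X]}
    (hc : IsMonicAntiPalindromic c m) (hf : IsAssociated c m f) :
    ∃ h : F[X], f = X ^ (q ^ m + 1) * h ∧ h.eval 0 = 1 := by
  have hq : 1 < q := Fintype.one_lt_card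
  have hdvd : X ∣ qPoly c (2 * m) := by
    refine Finset.dvd_sum fun i _ => Dvd.dvd.mul_left (dvd_pow_self _ (by positivity)) _
  obtain ⟨Ψ, hΨ⟩ := hdvd
  have hΨ0 : Ψ.eval 0 = -1 := by
    have h1 : (qPoly c (2 * m)).coeff 1 = Ψ.coeff 0 := by rw [hΨ, coeff_X_mul]
    rw [← coeff_zero_eq_eval_zero, ← h1, qPoly, finsetSum_coeff,
      Finset.sum_eq_single_of_mem 0 (by simp)]
    · have := hc.anti 0 (by omega)
      simp only [Nat.sub_zero, hc.monic] at this
      simp [this]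
    · intro i _ hi
      have : 1 < q ^ i := Nat.one_lt_pow hi hq
      rw [coeff_C_mul_X_pow, if_neg (by omega)]
  have hfac : f * (f ^ (q - 1) - 1) = X ^ (q ^ m + 1) * Ψ := by
    have : f * f ^ (q - 1) = f ^ q := by rw [← pow_succ', Nat.sub_add_cancel hq.le]
    rw [mul_sub, this, mul_one, hf.pow_sub, hΨ, pow_succ, mul_assoc]
  have hev : (f ^ (q - 1) - 1).eval 0 = -1 := by
    rw [eval_sub, eval_pow, hf.eval_zero, zero_pow (by omega), eval_one, zero_sub]
  have hcop : IsCoprime (X ^ (q ^ m + 1)) (f ^ (q - 1) - 1) := by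
    refine IsCoprime.pow_left (((prime_X (R := F)).coprime_iff_not_dvd).2 fun h => ?_)
    rw [X_dvd_iff, coeff_zero_eq_eval_zero, hev] at h
    simp at h
  obtain ⟨h, rfl⟩ := hcop.dvd_of_dvd_mul_right (Dvd.intro _ hfac.symm)
  refine ⟨h, rfl, ?_⟩
  rw [mul_assoc] at hfac
  have := mul_left_cancel₀ (pow_ne_zero _ X_ne_zero) hfac
  have := congrArg (eval 0) this
  rw [eval_mul, hev, hΨ0] at this
  linear_combination -this

end Polynomials

/-! ### Irreducibility of polynomials of degree one in t. -/

section Irreducibility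

theorem irreducible_C_X_mul_X_pow_add_map {F : Type*} [Field F] {B : F[X]} {a : ℕ} (hB : B.Monic)
    (ha : a < B.natDegree) (hB0 : B.eval 0 ≠ 0) :
    Irreducible (C RatFunc.X * X ^ a + B.map (algebraMap F (RatFunc F))) := by
  set p : F[X][X] := C X * X ^ a + B.map C with hp
  have hmonic : p.Monic := by
    refine (hB.map C).add_of_right ?_
    rw [hB.degree_map, degree_eq_natDegree hB.ne_zero]
    exact (degree_C_mul_X_pow_le _ _).trans_lt (by exact_mod_cast ha)
  have hirr : Irreducible p := by
    -- With the variables exchanged, `p` is linear with coprime coefficients x^a and B, because B(0)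
    -- ≠ 0.
    have hsw : Bivariate.swap p = C (X ^ a) * X + C B := by
      rw [hp, map_add, map_mul, map_pow, Bivariate.swap_map_C, Bivariate.swap_X, Bivariate.swap_Y,
        mul_comm, C_pow]
    rw [← MulEquiv.irreducible_iff (Bivariate.swap (R := F)), hsw]
    refine irreducible_C_mul_X_add_C (pow_ne_zero _ X_ne_zero) (IsCoprime.isRelPrime ?_)
    refine IsCoprime.pow_left (((prime_X (R := F)).coprime_iff_not_dvd).2 fun h => hB0 ?_)
    rwa [X_dvd_iff, coeff_zero_eq_eval_zero] at h
  -- Gauss's lemma; `a < B.natDegree` serves to make `p` monic in x.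
  have := (Monic.irreducible_iff_irreducible_map_fraction_map (K := RatFunc F) hmonic).1 hirr
  convert this using 1
  rw [hp, Polynomial.map_add, Polynomial.map_mul, Polynomial.map_pow, map_C, map_X, map_map,
    RatFunc.algebraMap_X]
  rfl

end Irreducibility

/-! ### The polynomials P - λ and their irreducible factors. -/

section Pencil

variable {F : Type*} [Field F] [Fintype F]

local notation "q" => Fintype.card F

/-- The polynomial `t x^(q^m + q^(m-1)) + f(x)` over `F(t)`. -/
def formPoly (m : ℕ) (f : F[X]) : (RatFunc F)[X] :=
  C RatFunc.X * X ^ (q ^ m + q ^ (m - 1)) + f.map (algebraMap F (RatFunc F))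

variable {c : ℕ → F} {m : ℕ} {f : F[X]}

theorem exponent_lt (hm : 2 ≤ m) : q ^ m + q ^ (m - 1) < q ^ (m - 1) * (q ^ m + 1) := by
  have hq : 1 < q := Fintype.one_lt_card
  have h1 : 1 < q ^ (m - 1) := Nat.one_lt_pow (by omega) hq
  have h2 : 0 < q ^ m := by positivity
  nlinarith

theorem formPoly_pow_sub (hm : 2 ≤ m) (hf : IsAssociated c m f) :
    formPoly m f ^ q - formPoly m f = X ^ (q ^ m) * L c m := by
  have h1 : f.map (algebraMap F (RatFunc F)) ^ q - f.map (algebraMap F (RatFunc F))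
      = X ^ (q ^ m) * (qPoly c (2 * m)).map (algebraMap F (RatFunc F)) := by
    rw [← Polynomial.map_pow, ← Polynomial.map_sub, hf.pow_sub, Polynomial.map_mul,
      Polynomial.map_pow, map_X]
  have h2 : (q ^ m + q ^ (m - 1)) * q = q ^ m + q ^ (m + 1) := by
    rw [add_mul, ← pow_succ, ← pow_succ, Nat.sub_add_cancel (by omega), add_comm]
  rw [formPoly, poly_add_pow_card (F := F), mul_pow, ← pow_mul, h2, L, ← C_pow, pow_add, pow_add]
  linear_combination h1

theorem derivative_X_pow_card_pow {A : Type*} [CommRing A] [Algebra F A] {i : ℕ} (hi : i ≠ 0) :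
    derivative (X ^ (q ^ i) : A[X]) = 0 := by
  have : ((q : ℕ) : A) = 0 := by
    rw [← map_natCast (algebraMap F A), FiniteField.cast_card_eq_zero, map_zero]
  rw [derivative_X_pow, Nat.cast_pow, this, zero_pow hi, C_0, zero_mul]

theorem derivative_L (hm : 2 ≤ m) (hc : IsMonicAntiPalindromic c m) :
    derivative (L c m) = -1 := by
  have h0 : c 0 = -1 := by simpa [hc.monic] using hc.anti 0 (by omega)
  have h1 : derivative (qPoly c (2 * m)) = -1 := by
    rw [qPoly, derivative_sum, Finset.sum_eq_single_of_mem 0 (by simp)]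
    · simp [h0]
    · intro i _ hi
      rw [derivative_C_mul, derivative_X_pow_card_pow hi, mul_zero]
  rw [L, derivative_sub, derivative_add, derivative_map, h1, derivative_C_mul, derivative_C_mul,
    derivative_X_pow_card_pow (by omega), derivative_X_pow_card_pow (by omega)]
  simp

theorem separable_L (hm : 2 ≤ m) (hc : IsMonicAntiPalindromic c m) : (L c m).Separable := by
  rw [separable_def, derivative_L hm hc]
  exact isCoprime_one_right.neg_right

/-- Differentiating P^q - P = x^(q^m) L leaves -P' = x^(q^m) L', and L' = -1. -/
theorem derivative_formPoly (hm : 2 ≤ m) (hc : IsMonicAntiPalindromic c m)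
    (hf : IsAssociated c m f) : derivative (formPoly m f) = X ^ (q ^ m) := by
  have h := congrArg derivative (formPoly_pow_sub hm hf)
  have h0 : ((q : ℕ) : RatFunc F) = 0 := by
    rw [← map_natCast (algebraMap F (RatFunc F)), FiniteField.cast_card_eq_zero, map_zero]
  rw [derivative_sub, derivative_pow, h0, derivative_mul, derivative_L hm hc,
    derivative_X_pow_card_pow (by omega)] at h
  simpa using h

theorem natDegree_formPoly (hm : 2 ≤ m) (hf : IsAssociated c m f) :
    (formPoly m f).natDegree = q ^ (m - 1) * (q ^ m + 1) := by
  rw [formPoly, natDegree_add_eq_right_of_natDegree_lt, natDegree_map, hf.natDegree_eq]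
  rw [natDegree_map, hf.natDegree_eq]
  exact (natDegree_C_mul_X_pow_le _ _).trans_lt (exponent_lt hm)

theorem monic_L (hm : 2 ≤ m) (hc : IsMonicAntiPalindromic c m) :
    (L c m).Monic ∧ (L c m).natDegree = q ^ (2 * m) := by
  have hq : 1 < q := Fintype.one_lt_card
  obtain ⟨h1, h2⟩ := qPoly_monic_and_natDegree c (2 * m) hc.monic
  set Φ := (qPoly c (2 * m)).map (algebraMap F (RatFunc F)) with hΦ
  have hΦm : Φ.Monic := h1.map _
  have hΦd : Φ.natDegree = q ^ (2 * m) := by rw [hΦ, natDegree_map, h2]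
  have hlt : (C (RatFunc.X ^ q) * X ^ (q ^ (m + 1)) - C RatFunc.X * X ^ (q ^ (m - 1)) :
      (RatFunc F)[X]).degree < Φ.degree := by
    rw [degree_eq_natDegree hΦm.ne_zero, hΦd]
    refine (degree_sub_le _ _).trans_lt (max_lt ?_ ?_) <;>
    · refine (degree_C_mul_X_pow_le _ _).trans_lt ?_
      exact_mod_cast Nat.pow_lt_pow_right hq (by omega)
  rw [L, add_sub_assoc]
  refine ⟨hΦm.add_of_left hlt, ?_⟩
  rw [natDegree_add_eq_left_of_degree_lt hlt, hΦd]

theorem exists_irreducible_factor (hm : 2 ≤ m) (hc : IsMonicAntiPalindromic c m)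
    (hf : IsAssociated c m f) (l : F) :
    ∃ (R : (RatFunc F)[X]) (n : ℕ), Irreducible R ∧ R.eval 0 ≠ 0 ∧
      formPoly m f - C (algebraMap F (RatFunc F) l) = X ^ n * R ∧ (l ≠ 0 → n = 0) ∧
      (l = 0 → n = q ^ m + 1) := by
  have hq : 1 < q := Fintype.one_lt_card
  have h1 : 1 < q ^ (m - 1) := Nat.one_lt_pow (by omega) hq
  by_cases hl : l = 0
  · obtain ⟨h, hfh, h0⟩ := hf.exists_eq_X_pow_mul hc
    have hmon : h.Monic := (monic_X_pow _).of_mul_monic_left (hfh ▸ hf.monic)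
    have hd : q ^ m + 1 + h.natDegree = q ^ (m - 1) * (q ^ m + 1) := by
      rw [← hf.natDegree_eq, hfh, (monic_X_pow _).natDegree_mul hmon, natDegree_X_pow]
    have hlt := exponent_lt (F := F) hm
    -- Dividing P by x^(q^m + 1) leaves a positive power of x beside t, since m ≥ 2, so the value at
    -- 0 is h(0) = 1.
    refine ⟨C RatFunc.X * X ^ (q ^ (m - 1) - 1) + h.map (algebraMap F (RatFunc F)), q ^ m + 1,
      irreducible_C_X_mul_X_pow_add_map hmon (by omega) (by rw [h0]; exact (one_ne_zero : (1 : F) ≠ 0)), ?_, ?_,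
      fun h => absurd hl h, fun _ => rfl⟩
    · rw [eval_add, eval_mul, eval_pow, eval_X, zero_pow (by omega), mul_zero, zero_add,
        eval_zero_map, h0, map_one]
      exact one_ne_zero
    · rw [formPoly, hl, map_zero, C_0, sub_zero, hfh, Polynomial.map_mul, Polynomial.map_pow, map_X,
        show q ^ m + q ^ (m - 1) = q ^ m + 1 + (q ^ (m - 1) - 1) by omega, pow_add _ (q ^ m + 1)]
      ring
  · have hdeg : (C l).degree < f.degree := by
      refine degree_lt_degree ?_
      rw [natDegree_C, hf.natDegree_eq]
      positivity
    have hB0 : (f - C l).eval 0 = -l := by rw [eval_sub, hf.eval_zero, eval_C, zero_sub]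
    have hform : formPoly m f - C (algebraMap F (RatFunc F) l) =
        C RatFunc.X * X ^ (q ^ m + q ^ (m - 1)) + (f - C l).map (algebraMap F (RatFunc F)) := by
      rw [formPoly, Polynomial.map_sub, map_C, add_sub_assoc]
    refine ⟨C RatFunc.X * X ^ (q ^ m + q ^ (m - 1)) + (f - C l).map (algebraMap F (RatFunc F)), 0,
      irreducible_C_X_mul_X_pow_add_map (hf.monic.sub_of_left hdeg) ?_ ?_, ?_,
      by rw [hform, pow_zero, one_mul], fun _ => rfl, fun h => absurd h hl⟩
    · rw [natDegree_sub_C, hf.natDegree_eq]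
      exact exponent_lt hm
    · rw [hB0]
      exact neg_ne_zero.2 hl
    · rw [eval_add, eval_mul, eval_pow, eval_X, zero_pow (by positivity), mul_zero, zero_add,
        eval_zero_map, hB0]
      exact (_root_.map_ne_zero _).2 (neg_ne_zero.2 hl)

/-- Since l^q = l, replacing P by P - l does not change P^q - P = x^(q^m) L; and `R` is coprime to
x. -/
theorem dvd_L_of_dvd_formPoly_sub (hm : 2 ≤ m) (hf : IsAssociated c m f) {l : F}
    {R : (RatFunc F)[X]} (hR0 : R.eval 0 ≠ 0)
    (hR : R ∣ formPoly m f - C (algebraMap F (RatFunc F) l)) : R ∣ L c m := by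
  have hq : q ≠ 0 := Fintype.card_ne_zero
  have h1 : R ∣ X ^ (q ^ m) * L c m := by
    have : X ^ (q ^ m) * L c m = (formPoly m f - C (algebraMap F (RatFunc F) l)) ^ q
        - (formPoly m f - C (algebraMap F (RatFunc F) l)) := by
      rw [poly_sub_pow_card (F := F), ← C_pow, ← map_pow, FiniteField.pow_card,
        ← formPoly_pow_sub hm hf]
      ring
    rw [this]
    exact dvd_sub (dvd_pow hR hq) hR
  refine IsCoprime.dvd_of_dvd_mul_left (IsCoprime.pow_right (IsCoprime.symm ?_)) h1
  refine ((prime_X (R := RatFunc F)).coprime_iff_not_dvd).2 fun h => hR0 ?_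
  rwa [X_dvd_iff, coeff_zero_eq_eval_zero] at h

end Pencil

/-! ### Values of P on V and the level sets as root sets. -/

section Roots

variable {F : Type*} [Field F] [Fintype F]
variable {E : Type*} [Field E] [Algebra (RatFunc F) E]

local notation "q" => Fintype.card F

variable {c : ℕ → F} {m : ℕ} {f : F[X]}

theorem aeval_formPoly_pow_sub (hm : 2 ≤ m) (hf : IsAssociated c m f) (v : E) :
    aeval v (formPoly m f) ^ q - aeval v (formPoly m f) = v ^ (q ^ m) * aeval v (L c m) := by
  rw [← map_pow, ← map_sub, formPoly_pow_sub hm hf, map_mul, map_pow, aeval_X]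

variable [Algebra F E] [IsScalarTower F (RatFunc F) E]

theorem mem_rootSpace_iff {v : E} : v ∈ rootSpace E c m ↔ aeval v (L c m) = 0 := Iff.rfl

theorem aeval_formPoly (v : E) : aeval v (formPoly m f) =
    algebraMap (RatFunc F) E RatFunc.X * v ^ (q ^ m + q ^ (m - 1)) + aeval v f := by
  simp only [formPoly, map_add, map_mul, map_pow, aeval_C, aeval_X, aeval_map_algebraMap]

theorem exists_algebraMap_eq_of_pow_card {A : Type*} [Field A] [Algebra F A] {x : A} (hx : x ^ q = x) : 
    ∃ a : F, algebraMap F A a = x := by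
  have hq : 1 < q := Fintype.one_lt_card
  have hs : (X ^ q - X : F[X]).Splits := by
    rw [splits_iff_card_roots, FiniteField.roots_X_pow_card_sub_X,
      FiniteField.X_pow_card_sub_X_natDegree_eq F hq]
    rfl
  refine hs.mem_range_of_isRoot (FiniteField.X_pow_card_sub_X_ne_zero F hq) ?_
  rw [IsRoot.def, Polynomial.map_sub, Polynomial.map_pow, map_X, eval_sub, eval_pow, eval_X, hx,
    sub_self]

theorem exists_algebraMap_eq_formPoly (hm : 2 ≤ m) (hf : IsAssociated c m f) {v : E}
    (hv : v ∈ rootSpace E c m) : ∃ a : F, algebraMap F E a = aeval v (formPoly m f) := by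
  refine exists_algebraMap_eq_of_pow_card ?_
  have := aeval_formPoly_pow_sub hm hf v
  rwa [mem_rootSpace_iff.1 hv, mul_zero, sub_eq_zero] at this

theorem mem_roots_factor_iff (hm : 2 ≤ m) (hf : IsAssociated c m f) {l : F}
    {R : (RatFunc F)[X]} {n : ℕ} (hR0 : R.eval 0 ≠ 0)
    (hR : formPoly m f - C (algebraMap F (RatFunc F) l) = X ^ n * R) (v : E) :
    aeval v R = 0 ↔
      v ≠ 0 ∧ v ∈ rootSpace E c m ∧ aeval v (formPoly m f) = algebraMap F E l := by
  have hv : aeval v (formPoly m f) - algebraMap F E l = v ^ n * aeval v R := by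
    have := congrArg (aeval v) hR
    rwa [map_sub, map_mul, map_pow, aeval_X, aeval_C, ← IsScalarTower.algebraMap_apply] at this
  constructor
  · intro h
    refine ⟨?_, ?_, ?_⟩
    · rintro rfl
      rw [← map_zero (algebraMap (RatFunc F) E), aeval_algebraMap_apply, coe_aeval_eq_eval] at h
      exact hR0 ((algebraMap (RatFunc F) E).injective h)
    · obtain ⟨S, hS⟩ := dvd_L_of_dvd_formPoly_sub hm hf hR0 (Dvd.intro_left _ hR.symm)
      rw [mem_rootSpace_iff, hS, map_mul, h, zero_mul]
    · rw [h, mul_zero, sub_eq_zero] at hv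
      exact hv
  · rintro ⟨h0, -, h⟩
    rw [h, sub_self, eq_comm] at hv
    exact (mul_eq_zero.1 hv).resolve_left (pow_ne_zero _ h0)

end Roots

/-! ### The quadratic form and its radical. -/

section Form

variable {F : Type*} [Field F] [Fintype F]
variable (E : Type*) [Field E] [Algebra F E] [Algebra (RatFunc F) E] [IsScalarTower F (RatFunc F) E]

local notation "q" => Fintype.card F

/-- The map `v ↦ v^(q^i)` on the space of roots, as an `F`-linear map to `E`. -/
def frobRoot (c : ℕ → F) (m i : ℕ) : rootSpace E c m →ₗ[F] E where
  toFun v := (v : E) ^ (q ^ i)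
  map_add' v w := add_pow_card_pow E i (v : E) w
  map_smul' a v := smul_pow_card_pow E i a (v : E)

/-- The `E`-valued quadratic map on the space of roots that is given by `formPoly`. -/
def quadE (c : ℕ → F) (m : ℕ) : QuadraticMap F (rootSpace E c m) E :=
  QuadraticMap.linMulLin
      (LinearMap.mulLeft F (algebraMap (RatFunc F) E RatFunc.X) ∘ₗ frobRoot E c m m)
      (frobRoot E c m (m - 1))
    + ∑ j ∈ Finset.range (m + 1), ∑ k ∈ Finset.range j,
      c (m + j) • QuadraticMap.linMulLin (frobRoot E c m (m + k)) (frobRoot E c m (m + k - j))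

theorem quadE_apply (c : ℕ → F) (m : ℕ) (v : rootSpace E c m) :
    quadE E c m v = aeval (v : E) (formPoly m (assoc c m)) := by
  rw [aeval_formPoly]
  simp only [quadE, assoc, add_apply, sum_apply, smul_apply,
    QuadraticMap.linMulLin_apply, LinearMap.comp_apply, LinearMap.mulLeft_apply, frobRoot,
    LinearMap.coe_mk, AddHom.coe_mk, map_sum, map_mul, map_pow, aeval_C, aeval_X, pow_add,
    Algebra.smul_def, mul_assoc]

variable {E}

theorem exists_quadraticForm {c : ℕ → F} {m : ℕ} (hm : 2 ≤ m) (hc : IsMonicAntiPalindromic c m)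
    {f : F[X]} (hf : IsAssociated c m f) : ∃ Q : QuadraticForm F (rootSpace E c m),
      ∀ v : rootSpace E c m, algebraMap F E (Q v) = aeval (v : E) (formPoly m f) := by
  obtain rfl := hf.unique (isAssociated_assoc hm hc)
  -- `quadE` has values in `E` that lie in the image of `F`; any `F`-linear retraction `π` of `E`
  -- onto `F` makes it an `F`-valued form without changing them.
  obtain ⟨π, hπ⟩ := LinearMap.exists_leftInverse_of_injective (Algebra.linearMap F E)
    (LinearMap.ker_eq_bot.2 (algebraMap F E).injective)
  refine ⟨π.compQuadraticMap (quadE E c m), fun v => ?_⟩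
  obtain ⟨a, ha⟩ := exists_algebraMap_eq_formPoly hm hf v.2
  rw [LinearMap.compQuadraticMap_apply, quadE_apply, ← ha]
  exact congrArg _ (LinearMap.congr_fun hπ a)

/-- P(x + w) - P(x) - P(w) has degree below q^(2m) = |V| and vanishes on V, so it is the zero
polynomial. Its derivative at x = 0 is w^(q^m). -/
theorem formPoly_radical_eq_zero {c : ℕ → F} {m : ℕ} (hm : 2 ≤ m)
    (hc : IsMonicAntiPalindromic c m) {f : F[X]} (hf : IsAssociated c m f)
    (hcard : Nat.card (rootSpace E c m) = q ^ (2 * m)) {w : E}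
    (hw : ∀ v ∈ rootSpace E c m, aeval (v + w) (formPoly m f) =
      aeval v (formPoly m f) + aeval w (formPoly m f)) : w = 0 := by
  have hq : 1 < q := Fintype.one_lt_card
  set P := (formPoly m f).map (algebraMap (RatFunc F) E) with hP
  have hPd : P.natDegree = q ^ (m - 1) * (q ^ m + 1) := by
    rw [hP, natDegree_map, natDegree_formPoly hm hf]
  have hlt : q ^ (m - 1) * (q ^ m + 1) < q ^ (2 * m) := by
    have h1 : q ^ (2 * m) = q ^ (m - 1) * (q * q ^ m) := by
      rw [← pow_succ', ← pow_add]
      congr 1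
      omega
    have h2 : 1 < q ^ m := Nat.one_lt_pow (by omega) hq
    rw [h1]
    exact Nat.mul_lt_mul_of_pos_left (by nlinarith) (by positivity)
  have hzero : P.comp (X + C w) - P - C (P.eval w) = 0 := by
    have : Finite (rootSpace E c m) := Nat.finite_of_card_ne_zero (by rw [hcard]; positivity)
    have := Fintype.ofFinite (rootSpace E c m)
    refine eq_zero_of_natDegree_lt_card_of_eval_eq_zero _
      (Subtype.val_injective : Function.Injective ((↑) : rootSpace E c m → E)) (fun v => ?_) ?_
    · simpa [hP, eval_map_algebraMap, sub_sub, sub_eq_zero] using hw v v.2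
    · rw [← Nat.card_eq_fintype_card, hcard]
      refine lt_of_le_of_lt ?_ hlt
      refine (natDegree_sub_le _ _).trans (max_le ((natDegree_sub_le _ _).trans
        (max_le ?_ hPd.le)) ?_)
      · rw [natDegree_comp, natDegree_X_add_C, mul_one, hPd]
      · rw [natDegree_C]
        positivity
  have hder : derivative P = X ^ (q ^ m) := by
    rw [hP, derivative_map, derivative_formPoly hm hc hf, Polynomial.map_pow, map_X]
  have h := congrArg (eval 0) (congrArg derivative hzero)
  rw [derivative_sub, derivative_sub, derivative_C, derivative_comp, hder] at h
  simpa [zero_pow (show q ^ m ≠ 0 by positivity)] using h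

end Form

/-! ### Counting roots, and the Galois action on them. -/

section SplittingField

variable {F : Type*} [Field F] [Fintype F]
variable {E : Type*} [Field E] [Algebra F E] [Algebra (RatFunc F) E] [IsScalarTower F (RatFunc F) E]

local notation "q" => Fintype.card F

variable {c : ℕ → F} {m : ℕ} {f : F[X]}

theorem ncard_roots_of_dvd_L (hm : 2 ≤ m) (hc : IsMonicAntiPalindromic c m)
    [IsSplittingField (RatFunc F) E (L c m)] {R : (RatFunc F)[X]} (hR : R ∣ L c m) :
    {v : rootSpace E c m | aeval (v : E) R = 0}.ncard = R.natDegree := by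
  have hL : L c m ≠ 0 := (monic_L hm hc).1.ne_zero
  have hR0 : R ≠ 0 := ne_zero_of_dvd_ne_zero hL hR
  have hsplit : (R.map (algebraMap (RatFunc F) E)).Splits :=
    (IsSplittingField.splits E (L c m)).of_dvd (Polynomial.map_ne_zero hL)
      (Polynomial.map_dvd _ hR)
  have h := card_rootSet_eq_natDegree ((separable_L hm hc).of_dvd hR) hsplit
  rw [← h, ← Nat.card_eq_fintype_card, Nat.card_coe_set_eq,
    ← Set.ncard_image_of_injective _ Subtype.val_injective]
  congr 1
  ext v
  simp only [Set.mem_image, Set.mem_ofPred_eq, Subtype.exists, exists_and_left, exists_prop,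
    exists_eq_right_right, mem_rootSet, hR0, ne_eq, not_false_eq_true, true_and]
  refine and_iff_left_of_imp fun hv => ?_
  obtain ⟨S, hS⟩ := hR
  rw [mem_rootSpace_iff, hS, map_mul, hv, zero_mul]

theorem card_rootSpace (hm : 2 ≤ m) (hc : IsMonicAntiPalindromic c m)
    [IsSplittingField (RatFunc F) E (L c m)] : Nat.card (rootSpace E c m) = q ^ (2 * m) := by
  have h := ncard_roots_of_dvd_L (E := E) hm hc (dvd_refl (L c m))
  have huniv : {v : rootSpace E c m | aeval (v : E) (L c m) = 0} = Set.univ :=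
    Set.eq_univ_of_forall fun v => v.2
  rwa [(monic_L hm hc).2, huniv, Set.ncard_univ] at h

theorem finrank_rootSpace (hm : 2 ≤ m) (hc : IsMonicAntiPalindromic c m)
    [IsSplittingField (RatFunc F) E (L c m)] : Module.finrank F (rootSpace E c m) = 2 * m := by
  have hq : 1 < q := Fintype.one_lt_card
  have h := card_rootSpace (E := E) hm hc
  have : Finite (rootSpace E c m) := Nat.finite_of_card_ne_zero (by rw [h]; positivity)
  have := Fintype.ofFinite (rootSpace E c m)
  rw [Nat.card_eq_fintype_card, Module.card_eq_pow_finrank (K := F)] at h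
  exact Nat.pow_right_injective hq h

theorem galRep_injective [IsSplittingField (RatFunc F) E (L c m)] :
    Function.Injective (galRep E c m) := by
  intro σ τ h
  have key : (σ : E →ₐ[RatFunc F] E) = τ := by
    refine AlgHom.ext_of_adjoin_eq_top (IsSplittingField.adjoin_rootSet E (L c m)) fun v hv => ?_
    exact congrArg Subtype.val (LinearEquiv.congr_fun h ⟨v, aeval_eq_zero_of_mem_rootSet hv⟩)
  exact AlgEquiv.ext fun v => AlgHom.congr_fun key v

theorem exists_algEquiv_of_roots {K A : Type*} [Field K] [Field A] [Algebra K A] [Normal K A]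
    {R : K[X]} (hR : Irreducible R) {v w : A} (hv : aeval v R = 0) (hw : aeval w R = 0) :
    ∃ σ : A ≃ₐ[K] A, σ v = w := by
  refine minpoly.exists_algEquiv_of_root' ⟨R, hR.ne_zero, hv⟩ ?_
  rw [← minpoly.eq_of_irreducible hR hv, map_mul, hw, zero_mul]

end SplittingField

end QAntiPalindromic

/-! ### Assembly of the main theorem. -/

open QAntiPalindromic in
theorem mainTheorem8 {F : Type*} [Field F] [Fintype F] (m : ℕ) (hm : 2 ≤ m)
    (c : ℕ → F) (hc : QAntiPalindromic.IsMonicAntiPalindromic c m)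
    {E : Type*} [Field E] [Algebra F E] [Algebra (RatFunc F) E]
    [IsScalarTower F (RatFunc F) E]
    [Polynomial.IsSplittingField (RatFunc F) E (QAntiPalindromic.L c m)] :
    (∃! f : Polynomial F, QAntiPalindromic.IsAssociated c m f) ∧
    ∀ f : Polynomial F, QAntiPalindromic.IsAssociated c m f →
      ∃ Q : QuadraticForm F (QAntiPalindromic.rootSpace E c m),
        (∀ v : QAntiPalindromic.rootSpace E c m,
          algebraMap F E (Q v) =
            algebraMap (RatFunc F) E RatFunc.X *
                (v : E) ^ (Fintype.card F ^ m + Fintype.card F ^ (m - 1))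
              + Polynomial.aeval (v : E) f) ∧
        QAntiPalindromic.IsMinusType Q m ∧
        Function.Injective (QAntiPalindromic.galRep E c m) ∧
        (QAntiPalindromic.galRep E c m).range ≤ QAntiPalindromic.orthogonalGroup Q ∧
        ∀ l : F,
          {v : QAntiPalindromic.rootSpace E c m | v ≠ 0 ∧ Q v = l}.Nonempty ∧
          ∀ v w : QAntiPalindromic.rootSpace E c m,
            v ≠ 0 → w ≠ 0 → Q v = l → Q w = l →
              ∃ σ : E ≃ₐ[RatFunc F] E, QAntiPalindromic.galRep E c m σ v = w := by
  refine ⟨⟨assoc c m, isAssociated_assoc hm hc, fun g hg => hg.unique (isAssociated_assoc hm hc)⟩,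
    fun f hf => ?_⟩
  have hq : 1 < Fintype.card F := Fintype.one_lt_card
  obtain ⟨Q, hQ⟩ := exists_quadraticForm (E := E) hm hc hf
  have hinj : Function.Injective (algebraMap F E) := (algebraMap F E).injective
  have hroots : ∀ (l : F) (R : (RatFunc F)[X]) (n : ℕ), R.eval 0 ≠ 0 →
      formPoly m f - C (algebraMap F (RatFunc F) l) = X ^ n * R →
      ∀ v : rootSpace E c m, aeval (v : E) R = 0 ↔ v ≠ 0 ∧ Q v = l := by
    intro l R n hR0 hR v
    rw [mem_roots_factor_iff hm hf hR0 hR, ← hQ, hinj.eq_iff]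
    simp
  have hcount : ∀ (l : F) (R : (RatFunc F)[X]) (n : ℕ), R.eval 0 ≠ 0 →
      formPoly m f - C (algebraMap F (RatFunc F) l) = X ^ n * R →
      {v : rootSpace E c m | v ≠ 0 ∧ Q v = l}.ncard = R.natDegree := by
    intro l R n hR0 hR
    rw [← ncard_roots_of_dvd_L (E := E) hm hc
      (dvd_L_of_dvd_formPoly_sub hm hf hR0 (Dvd.intro_left _ hR.symm))]
    simp only [hroots l R n hR0 hR]
  have hrad : ∀ w : rootSpace E c m, (∀ v, QuadraticMap.polarBilin Q v w = 0) → w = 0 := by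
    intro w hw
    refine Subtype.ext (formPoly_radical_eq_zero hm hc hf (card_rootSpace hm hc) fun v hv => ?_)
    have h := hw ⟨v, hv⟩
    rw [QuadraticMap.polarBilin_apply_apply, QuadraticMap.polar, sub_sub, sub_eq_zero] at h
    have h' := congrArg (algebraMap F E) h
    rw [RingHom.map_add, hQ, hQ, hQ] at h'
    exact h'
  refine ⟨Q, fun v => by rw [hQ, aeval_formPoly], ⟨finrank_rootSpace hm hc, ⟨?_, hrad⟩, ?_⟩,
    galRep_injective, ?_, fun l => ?_⟩
  · intro w hw
    refine hrad w fun v => ?_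
    have h := hw v
    rwa [QuadraticMap.polarBilin_apply_apply, QuadraticMap.polar_comm] at h
  -- The count is deg `R` = q^(m-1) (q^m + 1) - (q^m + 1).
  · obtain ⟨R, n, -, hR0, hR, -, hn⟩ := exists_irreducible_factor hm hc hf 0
    have hRne : R ≠ 0 := fun h => hR0 (by rw [h, eval_zero])
    rw [hcount 0 R n hR0 hR]
    have hd := congrArg natDegree hR
    rw [map_zero, C_0, sub_zero, natDegree_formPoly hm hf,
      natDegree_mul (pow_ne_zero _ X_ne_zero) hRne, natDegree_X_pow, hn rfl] at hd
    rw [Nat.sub_mul, hd, one_mul, Nat.add_sub_cancel_left]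
  · rintro _ ⟨σ, rfl⟩ v
    refine hinj ?_
    rw [hQ, hQ]
    have h1 : aeval (σ (v : E)) (formPoly m f) = σ (aeval (v : E) (formPoly m f)) :=
      aeval_algHom_apply (σ : E →ₐ[RatFunc F] E) (v : E) _
    refine h1.trans ?_
    rw [← hQ, IsScalarTower.algebraMap_apply F (RatFunc F) E, σ.commutes]
  · obtain ⟨R, n, hirr, hR0, hR, -, -⟩ := exists_irreducible_factor hm hc hf l
    constructor
    · refine Set.nonempty_of_ncard_ne_zero ?_
      rw [hcount l R n hR0 hR]
      exact hirr.natDegree_pos.ne'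
    · intro v w hv hw hvl hwl
      have : Normal (RatFunc F) E := Normal.of_isSplittingField (L c m)
      obtain ⟨σ, hσ⟩ := exists_algEquiv_of_roots hirr ((hroots l R n hR0 hR v).2 ⟨hv, hvl⟩)
        ((hroots l R n hR0 hR w).2 ⟨hw, hwl⟩)
      exact ⟨σ, Subtype.ext hσ⟩

end
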